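/- Let $Z$ be a paracompact Hausdorff space, $g\colon Z\to Z$ a continuous map, and $K\subseteq Z$ a compact, globally asymptotically stable attractor of $g$: (i) every neighbourhood of $K$ contains a neighbourhood $P$ of $K$ with $g(P)\subseteq P$, and (ii) for every $p\in Z$ and every neighbourhood $P$ of $K$ there is $n\ge 0$ with $g^n(p)\in P$. (In particular $g(K)\subseteq K$.) Let $R$ be a commutative ring with unit, let $q\ge 0$, and let $\check H^q(Z,K)=\check H^q(Z,K;R)$ denote relative Čech cohomology, defined through Alexander–Spanier cochains (arbitrary functions $\xi\colon Z^{q+1}\to R$, modulo those that vanish on a neighbourhood of the diagonal). Let $\pi\colon (Z,K)\to (Z/K,a)$ be the projection that collapses $K$ to a point $a$, and let $\bar g\colon Z/K\to Z/K$ be the map induced by $g$. (If $K=\emptyset$, then $Z=\emptyset$, and the pair $(Z/K,a)$ is read as $(\emptyset,\emptyset)$.) Then: (1) Every class in $\check H^q(Z,K)$ has the form $\pi^*[\xi]$, where $\xi\colon (Z/K)^{q+1}\to R$ is a relative cocycle of $(Z/K,a)$ that vanishes on $P^{q+1}$ for some neighbourhood $P$ of $a$. (2) For every such $\xi$ and every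 formal power series $A(x)=\sum_{j\ge 0}a_jx^j\in R[[x]]$, the expression $$S_A(\xi)(z_0,\dots,z_q)=\sum_{j\ge 0}a_j\,\xi(\bar g^j(z_0),\dots,\bar g^j(z_q))$$ is a finite sum for every tuple $(z_0,\dots,z_q)$, $S_A(\xi)$ is again a relative cocycle of $(Z/K,a)$, and $$A(g^*)\colon \pi^*[\xi]\longmapsto \pi^*[S_A(\xi)]$$ is a well defined $R$-linear endomorphism of $\check H^q(Z,K)$. For a polynomial $A$ it is the usual $\sum_j a_j(g^*)^j$. (3) The assignment $A\mapsto A(g^*)$ is a ring homomorphism $R[[x]]\to \operatorname{End}_R(\check H^q(Z,K))$: it sends $1$ to $\mathrm{Id}$, and $(A+B)(g^*)=A(g^*)+B(g^*)$ and $(AB)(g^*)=A(g^*)\circ B(g^*)$ for all $A,B\in R[[x]]$. (4) No unit $\lambda\in R$ is an eigenvalue of $g^*$ on $\check H^q(Z,K)$, i.e. $g^*u=\lambda u$ implies $u=0$. In particular, if $R$ is a field, $g^*$ has no nonzero eigenvalues on $\check H^q(Z,K)$. -/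

import Mathlib

open Set Topology

namespace AlexanderSpanier

universe u v w

/-- Alexander-Spanier `q`-cochains: arbitrary functions `Z^(q+1) → R`. -/
abbrev Cochain (R : Type v) (Z : Type u) (q : ℕ) : Type (max u v) := (Fin (q + 1) → Z) → R

section Cohomology

variable (R : Type v) [CommRing R] {Z : Type u}

/-- The coboundary
`(∂ξ)(z₀, …, z_{q+1}) = ∑ j, (-1)^j ξ(z₀, …, (z_j omitted), …, z_{q+1})`. -/
def coboundary (q : ℕ) : Cochain R Z q →ₗ[R] Cochain R Z (q + 1) where
  toFun ξ := fun z => ∑ j : Fin (q + 2), (-1) ^ (j : ℕ) * ξ (fun i => z (j.succAbove i))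
  map_add' ξ η := by
    funext z
    simp [mul_add, Finset.sum_add_distrib]
  map_smul' c ξ := by
    funext z
    simp only [Pi.smul_apply, smul_eq_mul, RingHom.id_apply, Finset.mul_sum]
    exact Finset.sum_congr rfl fun j _ => by ring

variable [TopologicalSpace Z]

/-- The cochains `ξ` whose restriction to `S` is locally zero: every point of `S` has a
neighbourhood `U` such that `ξ` vanishes on all tuples of points of `U ∩ S`. -/
def locallyZeroOn (S : Set Z) (q : ℕ) : Submodule R (Cochain R Z q) where
  carrier := {ξ | ∀ s ∈ S, ∃ U ∈ 𝓝 s, ∀ z : Fin (q + 1) → Z, (∀ i, z i ∈ U ∩ S) → ξ z = 0}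
  zero_mem' := fun _ _ => ⟨univ, Filter.univ_mem, fun _ _ => rfl⟩
  add_mem' := by
    intro ξ η hξ hη s hs
    obtain ⟨U, hU, h1⟩ := hξ s hs
    obtain ⟨V, hV, h2⟩ := hη s hs
    refine ⟨U ∩ V, Filter.inter_mem hU hV, fun z hz => ?_⟩
    simp [h1 z fun i => ⟨(hz i).1.1, (hz i).2⟩, h2 z fun i => ⟨(hz i).1.2, (hz i).2⟩]
  smul_mem' := by
    intro c ξ hξ s hs
    obtain ⟨U, hU, h1⟩ := hξ s hs
    exact ⟨U, hU, fun z hz => by simp [h1 z hz]⟩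

/-- The locally zero cochains on the whole space. -/
abbrev locallyZero (Z : Type u) [TopologicalSpace Z] (q : ℕ) : Submodule R (Cochain R Z q) :=
  locallyZeroOn R (univ : Set Z) q

/-- Representatives of relative cocycles: the relative cochain module of `(Z, K)` is
`locallyZeroOn R K q` modulo `locallyZero R Z q`, and these are the `ξ` whose class is
annihilated by the induced coboundary. -/
def cocycles (K : Set Z) (q : ℕ) : Submodule R (Cochain R Z q) :=
  locallyZeroOn R K q ⊓ (locallyZero R Z (q + 1)).comap (coboundary R q)

/-- Representatives of relative coboundaries: cochains that differ by a locally zero cochain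
from the coboundary of a relative cochain of degree `q - 1` (of `0`, if `q = 0`). -/
def coboundaries (K : Set Z) : (q : ℕ) → Submodule R (Cochain R Z q)
  | 0 => locallyZero R Z 0
  | q + 1 => locallyZero R Z (q + 1) ⊔ (locallyZeroOn R K q).map (coboundary R q)

/-- The relative Alexander-Spanier cohomology module of the pair `(Z, K)` in degree `q`, with
coefficients in `R`. -/
abbrev Cohomology (K : Set Z) (q : ℕ) : Type (max u v) :=
  cocycles R K q ⧸ (coboundaries R K q).submoduleOf (cocycles R K q)

variable {R}

/-- The cohomology class represented by `ξ`. -/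
def classOf {K : Set Z} {q : ℕ} (ξ : Cochain R Z q) (hξ : ξ ∈ cocycles R K q) :
    Cohomology R K q :=
  Submodule.Quotient.mk ⟨ξ, hξ⟩

/-- `ξ` vanishes on `P^(q+1)` for some neighbourhood `P` of `K`. -/
def VanishesNear {q : ℕ} (K : Set Z) (ξ : Cochain R Z q) : Prop :=
  ∃ P ∈ 𝓝ˢ K, ∀ z : Fin (q + 1) → Z, (∀ i, z i ∈ P) → ξ z = 0

end Cohomology

section Pullback

variable (R : Type v) [CommRing R] {X : Type u} {Y : Type w}

/-- `(f^* ξ)(z₀, …, z_q) = ξ(f z₀, …, f z_q)`. -/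
def cochainPullback (f : X → Y) (q : ℕ) : Cochain R Y q →ₗ[R] Cochain R X q where
  toFun ξ := fun z => ξ (fun i => f (z i))
  map_add' _ _ := rfl
  map_smul' _ _ := rfl

theorem coboundary_cochainPullback (f : X → Y) (q : ℕ) (ξ : Cochain R Y q) :
    coboundary R q (cochainPullback R f q ξ) = cochainPullback R f (q + 1) (coboundary R q ξ) :=
  rfl

variable [TopologicalSpace X] [TopologicalSpace Y]

theorem cochainPullback_mem_locallyZeroOn (f : C(X, Y)) {S : Set X} {T : Set Y}
    (h : MapsTo f S T) (q : ℕ) {ξ : Cochain R Y q} (hξ : ξ ∈ locallyZeroOn R T q) :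
    cochainPullback R f q ξ ∈ locallyZeroOn R S q := by
  intro s hs
  obtain ⟨U, hU, h1⟩ := hξ (f s) (h hs)
  exact ⟨f ⁻¹' U, f.continuous.continuousAt hU,
    fun z hz => h1 _ fun i => ⟨(hz i).1, h (hz i).2⟩⟩

theorem cochainPullback_mem_cocycles (f : C(X, Y)) {S : Set X} {T : Set Y}
    (h : MapsTo f S T) (q : ℕ) {ξ : Cochain R Y q} (hξ : ξ ∈ cocycles R T q) :
    cochainPullback R f q ξ ∈ cocycles R S q :=
  ⟨cochainPullback_mem_locallyZeroOn R f h q hξ.1,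
    cochainPullback_mem_locallyZeroOn R f (mapsTo_univ_iff.2 fun _ => mem_univ _) (q + 1) hξ.2⟩

theorem cochainPullback_mem_coboundaries (f : C(X, Y)) {S : Set X} {T : Set Y}
    (h : MapsTo f S T) (q : ℕ) {ξ : Cochain R Y q} (hξ : ξ ∈ coboundaries R T q) :
    cochainPullback R f q ξ ∈ coboundaries R S q := by
  have hu : MapsTo f univ univ := mapsTo_univ_iff.2 fun _ => mem_univ _
  cases q with
  | zero => exact cochainPullback_mem_locallyZeroOn R f hu 0 hξ
  | succ q =>
    obtain ⟨η, hη, ζ, ⟨φ, hφ, rfl⟩, rfl⟩ := Submodule.mem_sup.1 hξ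
    rw [map_add, ← coboundary_cochainPullback]
    exact Submodule.add_mem_sup (cochainPullback_mem_locallyZeroOn R f hu (q + 1) hη)
      ⟨_, cochainPullback_mem_locallyZeroOn R f h q hφ, rfl⟩

/-- The homomorphism `f^*` induced in cohomology by a continuous map of pairs
`f : (X, S) → (Y, T)`. -/
def pullback (f : C(X, Y)) {S : Set X} {T : Set Y} (h : MapsTo f S T) (q : ℕ) :
    Cohomology R T q →ₗ[R] Cohomology R S q :=
  Submodule.mapQ _ _
    ((cochainPullback R f q).restrict fun _ hξ => cochainPullback_mem_cocycles R f h q hξ)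
    fun _ hξ => cochainPullback_mem_coboundaries R f h q hξ

end Pullback

section Dynamics

variable {Z : Type u} [TopologicalSpace Z]

/-- `K` is a compact, asymptotically stable attractor of `g` whose basin of attraction is all
of `Z`. -/
structure IsGlobalAttractor (g : C(Z, Z)) (K : Set Z) : Prop where
  isCompact : IsCompact K
  /-- the positively invariant neighbourhoods of `K` form a neighbourhood basis of `K` -/
  stable : ∀ U ∈ 𝓝ˢ K, ∃ P ∈ 𝓝ˢ K, P ⊆ U ∧ MapsTo g P P
  /-- every orbit enters every neighbourhood of `K` -/
  attracts : ∀ p : Z, ∀ P ∈ 𝓝ˢ K, ∃ n : ℕ, g^[n] p ∈ P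

theorem IsGlobalAttractor.mapsTo [T1Space Z] {g : C(Z, Z)} {K : Set Z}
    (hK : IsGlobalAttractor g K) : MapsTo g K K := by
  intro x hx
  by_contra hgx
  obtain ⟨P, hP, hPU, hPP⟩ := hK.stable {g x}ᶜ
    (isOpen_compl_singleton.mem_nhdsSet.2 fun y hy h => hgx (h ▸ hy))
  exact hPU (hPP (subset_of_mem_nhdsSet hP hx)) rfl

/-- The equivalence relation identifying all points of `K` with each other. -/
def collapseSetoid (K : Set Z) : Setoid Z where
  r x y := x = y ∨ (x ∈ K ∧ y ∈ K)
  iseqv := by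
    refine ⟨fun x => Or.inl rfl, ?_, ?_⟩
    · rintro x y (rfl | ⟨h, h'⟩)
      · exact Or.inl rfl
      · exact Or.inr ⟨h', h⟩
    · rintro x y z (rfl | ⟨h, h'⟩) (rfl | ⟨k, k'⟩)
      · exact Or.inl rfl
      · exact Or.inr ⟨k, k'⟩
      · exact Or.inr ⟨h, h'⟩
      · exact Or.inr ⟨h, k'⟩

/-- The quotient space `Z/K`, with the quotient topology. -/
abbrev Collapse (K : Set Z) : Type u := Quotient (collapseSetoid K)

/-- The projection `Z → Z/K`. -/
def collapseMap (K : Set Z) : C(Z, Collapse K) :=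
  ⟨Quotient.mk (collapseSetoid K), continuous_quotient_mk'⟩

/-- The image of `K` in `Z/K`: the one-point set `{a}` if `K` is nonempty. -/
abbrev collapsePoint (K : Set Z) : Set (Collapse K) := collapseMap K '' K

/-- The map `Z/K → Z/K` induced by a map `g` with `g(K) ⊆ K`. -/
def collapseInduced (g : C(Z, Z)) {K : Set Z} (h : MapsTo g K K) : C(Collapse K, Collapse K) :=
  ⟨Quotient.map g (by
      rintro x y (rfl | ⟨hx, hy⟩)
      · exact Or.inl rfl
      · exact Or.inr ⟨h hx, h hy⟩),
    g.continuous.quotient_map' _⟩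

/-- The cochain
`(z₀, …, z_q) ↦ ∑ j, a_j ξ(g^j z₀, …, g^j z_q)` for the series `A = ∑ j, a_j x^j`; the sum
is used only where it has finitely many nonzero terms for each tuple. -/
noncomputable def seriesCochain {R : Type v} [CommRing R] {q : ℕ} (g : Z → Z)
    (A : PowerSeries R) (ξ : Cochain R Z q) : Cochain R Z q :=
  fun z => ∑ᶠ j : ℕ, PowerSeries.coeff j A * ξ (fun i => g^[j] (z i))

end Dynamics

end AlexanderSpanier

/-! If `ξ` vanishes near `K`, stability and attraction give each point a neighbourhood whose
iterates, from one common time on, stay where `ξ` vanishes. So near each point only finitely many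
terms of `∑ a_j ξ ∘ g^j` survive. Hence the series acts linearly on cochains vanishing near `K`,
turns products of series into composition, commutes with `∂` and preserves local vanishing.

To pass to cohomology, cochains must be moved so that they vanish near `K`. This is tautness of the
compact set `K` (`exists_vanishesNear_sub_mem_coboundaries`). Cochains can be pulled back along
discontinuous maps, so a neighbourhood of `K` is retracted onto `K` discontinuously but with small
displacement, and the prism homotopy compares the pullback with the original. Tautness for cocycles
gives representatives (`nearClass_surjective`); for primitives it gives independence of the
representative (`seriesCochain_mem_coboundaries`). The same homotopy, for a set-theoretic section of
`Z → Z/K`, moves representatives to `Z/K` (`exists_collapse_cocycle`).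

For a unit `c`, the series `x - c` is a unit of `R[[x]]`, so `g^* - c` is invertible. -/

namespace AlexanderSpanier

universe u v

/-! ### The coboundary and the prism homotopy, by recursion on the first variable. -/

section Prism

variable (R : Type v) [CommRing R] {Z : Type u}

/-- The coboundary on functions of `n` variables, including `n = 0`. -/
def augCoboundary (n : ℕ) (ξ : (Fin n → Z) → R) : (Fin (n + 1) → Z) → R :=
  fun z => ∑ j : Fin (n + 1), (-1) ^ (j : ℕ) * ξ (fun i => z (j.succAbove i))

variable {R}

theorem augCoboundary_sub (n : ℕ) (ξ η : (Fin n → Z) → R) :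
    augCoboundary R n (ξ - η) = augCoboundary R n ξ - augCoboundary R n η := by
  funext z
  simp [augCoboundary, mul_sub, Finset.sum_sub_distrib]

/-- The function obtained by fixing the first variable. -/
def slice {n : ℕ} (ξ : (Fin (n + 1) → Z) → R) (a : Z) : (Fin n → Z) → R :=
  fun y => ξ (Fin.cons a y)

/-- The face omitting `a` gives `ξ y`; every other face keeps `a` in front, with its sign shifted by
one. This recursion replaces all manipulation of double alternating sums below. -/
theorem augCoboundary_cons (n : ℕ) (ξ : (Fin (n + 1) → Z) → R) (a : Z) (y : Fin (n + 1) → Z) :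
    augCoboundary R (n + 1) ξ (Fin.cons a y) = ξ y - augCoboundary R n (slice ξ a) y := by
  have h : ∀ j : Fin (n + 1),
      (fun i => (Fin.cons a y : Fin (n + 2) → Z) (j.succ.succAbove i)) =
        Fin.cons a (fun i => y (j.succAbove i)) := by
    intro j
    funext i
    refine Fin.cases ?_ (fun i => ?_) i
    · simp
    · simp [Fin.succ_succAbove_succ]
  unfold augCoboundary slice
  rw [Fin.sum_univ_succ, sub_eq_add_neg, ← Finset.sum_neg_distrib]
  congr 1
  · simp
  · refine Finset.sum_congr rfl fun j _ => ?_
    rw [h j, Fin.val_succ, pow_succ]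
    ring

theorem slice_augCoboundary (n : ℕ) (ξ : (Fin (n + 1) → Z) → R) (a : Z) :
    slice (augCoboundary R (n + 1) ξ) a = ξ - augCoboundary R n (slice ξ a) :=
  funext fun y => augCoboundary_cons n ξ a y

theorem augCoboundary_augCoboundary (n : ℕ) (ξ : (Fin n → Z) → R) :
    augCoboundary R (n + 1) (augCoboundary R n ξ) = 0 := by
  induction n with
  | zero =>
    funext z
    simp only [augCoboundary, Fin.sum_univ_succ, Finset.univ_eq_empty, Finset.sum_empty]
    simp [Subsingleton.elim (fun i : Fin 0 => z _) (fun i : Fin 0 => z i.elim0)]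
  | succ n ih =>
    funext z
    rw [← Fin.cons_self_tail z, augCoboundary_cons, slice_augCoboundary, augCoboundary_sub, ih]
    simp

theorem coboundary_coboundary (q : ℕ) (ξ : Cochain R Z q) :
    coboundary R (q + 1) (coboundary R q ξ) = 0 :=
  augCoboundary_augCoboundary (q + 1) ξ

theorem coboundary_eq_zero {T : Set Z} {q : ℕ} {ξ : Cochain R Z q}
    (h : ∀ z : Fin (q + 1) → Z, (∀ i, z i ∈ T) → ξ z = 0) (z : Fin (q + 2) → Z)
    (hz : ∀ i, z i ∈ T) : coboundary R q ξ z = 0 := by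
  change ∑ j : Fin (q + 2), (-1) ^ (j : ℕ) * ξ (fun i => z (j.succAbove i)) = 0
  exact Finset.sum_eq_zero fun j _ => by rw [h _ fun i => hz _, mul_zero]

/-- The prism operator
`(Dξ)(z₁, …, zₙ) = ∑ i, (-1)^(i-1) ξ(z₁, …, zᵢ, f zᵢ, …, f zₙ)`, defined by recursion on the
number of variables. -/
def prism (f : Z → Z) : (n : ℕ) → ((Fin (n + 1) → Z) → R) → ((Fin n → Z) → R)
  | 0, _ => 0
  | n + 1, ξ => fun z =>
      ξ (Fin.cons (z 0) fun i => f (z i)) - prism f n (slice ξ (z 0)) (Fin.tail z)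

theorem prism_cons (f : Z → Z) (n : ℕ) (ξ : (Fin (n + 2) → Z) → R) (a : Z) (y : Fin n → Z) :
    prism f (n + 1) ξ (Fin.cons a y) =
      ξ (Fin.cons a (Fin.cons (f a) fun i => f (y i))) - prism f n (slice ξ a) y := by
  have h : (fun i => f ((Fin.cons a y : Fin (n + 1) → Z) i)) = Fin.cons (f a) fun i => f (y i) := by
    funext i
    refine Fin.cases ?_ (fun i => ?_) i <;> simp
  simp [prism, h]

theorem slice_prism (f : Z → Z) (n : ℕ) (ξ : (Fin (n + 2) → Z) → R) (a : Z) :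
    slice (prism f (n + 1) ξ) a =
      (fun y => slice (slice ξ a) (f a) fun i => f (y i)) - prism f n (slice ξ a) :=
  funext fun y => prism_cons f n ξ a y

theorem prism_sub (f : Z → Z) (n : ℕ) (ξ η : (Fin (n + 1) → Z) → R) :
    prism f n (ξ - η) = prism f n ξ - prism f n η := by
  induction n with
  | zero => simp [prism]
  | succ n ih =>
    funext z
    have : slice (ξ - η) (z 0) = slice ξ (z 0) - slice η (z 0) := rfl
    simp only [prism, this, ih, Pi.sub_apply]
    ring

/-- The prism operator is a cochain homotopy from the identity to `f^*`. -/
theorem augCoboundary_prism_add (f : Z → Z) (n : ℕ) (ξ : (Fin (n + 1) → Z) → R) :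
    augCoboundary R n (prism f n ξ) + prism f (n + 1) (augCoboundary R (n + 1) ξ) =
      (fun z => ξ fun i => f (z i)) - ξ := by
  induction n with
  | zero =>
    funext z
    rw [← Fin.cons_self_tail z]
    generalize z 0 = a
    generalize Fin.tail z = y
    have h : (Fin.cons (f a) fun i => f (y i) : Fin 1 → Z) =
        fun i => f ((Fin.cons a y : Fin 1 → Z) i) := by
      funext i
      refine Fin.cases ?_ (fun i => ?_) i <;> simp
    have h' : (fun i => f (y i)) = y := Subsingleton.elim _ _
    simp only [Pi.add_apply, Pi.sub_apply, prism_cons, augCoboundary_cons, h]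
    simp [prism, augCoboundary, slice]
    exact congrArg _ (congrArg _ (Subsingleton.elim _ _))
  | succ n ih =>
    funext z
    rw [← Fin.cons_self_tail z]
    generalize z 0 = a
    generalize Fin.tail z = y
    have h : (Fin.cons (f a) fun i => f (y i) : Fin (n + 2) → Z) =
        fun i => f ((Fin.cons a y : Fin (n + 2) → Z) i) := by
      funext i
      refine Fin.cases ?_ (fun i => ?_) i <;> simp
    have key := congrFun (ih (slice ξ a)) y
    simp only [Pi.add_apply, Pi.sub_apply] at key ⊢
    have hc : augCoboundary R n (fun y => slice (slice ξ a) (f a) fun i => f (y i)) y =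
      augCoboundary R n (slice (slice ξ a) (f a)) fun i => f (y i) := rfl
    -- After expansion, `prism f _ ξ y` and the coboundaries of the double slice at `a`, `f a`
    -- cancel. What remains is the induction hypothesis for `slice ξ a`.
    rw [augCoboundary_cons, slice_prism, augCoboundary_sub, prism_cons, augCoboundary_cons,
      augCoboundary_cons, slice_augCoboundary, prism_sub, Pi.sub_apply, Pi.sub_apply, hc, ← h]
    have e : slice ξ a y = ξ (Fin.cons a y) := rfl
    rw [← e]
    linear_combination key

/-- Each term evaluates `ξ` on a tuple made of entries `z i` and `f (z i)`, all in `T`. No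
continuity of `f` is involved. -/
theorem prism_eq_zero (f : Z → Z) {T : Set Z} (n : ℕ) (ξ : (Fin (n + 1) → Z) → R)
    (hξ : ∀ z, (∀ i, z i ∈ T) → ξ z = 0) (z : Fin n → Z) (hz : ∀ i, z i ∈ T)
    (hfz : ∀ i, f (z i) ∈ T) : prism f n ξ z = 0 := by
  induction n with
  | zero => rfl
  | succ n ih =>
    change ξ _ - prism f n _ _ = 0
    rw [hξ, ih, sub_zero]
    · intro y hy
      exact hξ _ fun i => Fin.cases (hz 0) (fun i => by simpa using hy i) i
    · exact fun i => hz i.succ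
    · exact fun i => hfz i.succ
    · exact fun i => Fin.cases (by simpa using hz 0) (fun i => by simpa using hfz i) i

variable [TopologicalSpace Z]

/-- If the prism operator sends `ξ` to a relative cochain, then `f^* ξ - D ∂ ξ` differs from `ξ`
by a relative coboundary. -/
theorem pullback_sub_prism_sub_mem_coboundaries (f : Z → Z) {K : Set Z} (q : ℕ)
    (ξ : Cochain R Z q)
    (h : ∀ s ∈ K, ∃ U ∈ 𝓝 s, ∃ T : Set Z, U ∩ K ⊆ T ∧ MapsTo f (U ∩ K) T ∧
      ∀ z : Fin (q + 1) → Z, (∀ i, z i ∈ T) → ξ z = 0) :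
    cochainPullback R f q ξ - prism f (q + 1) (coboundary R q ξ) - ξ ∈ coboundaries R K q := by
  have key := augCoboundary_prism_add f q ξ
  have e : cochainPullback R f q ξ - prism f (q + 1) (coboundary R q ξ) - ξ =
      augCoboundary R q (prism f q ξ) := by
    rw [sub_right_comm, sub_eq_iff_eq_add]
    exact key.symm
  rw [e]
  cases q with
  | zero =>
    have : augCoboundary R 0 (prism f 0 ξ) = 0 := by
      funext z
      simp [augCoboundary, prism]
    rw [this]
    exact Submodule.zero_mem _
  | succ q =>
    -- Near `s`, both the points of `K` and their images lie in a set `T` on which `ξ` vanishes, so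
    -- the prism of `ξ` is a relative cochain.
    refine Submodule.mem_sup_right ⟨prism f (q + 1) ξ, fun s hs => ?_, rfl⟩
    obtain ⟨U, hU, T, hT, hfT, hξ⟩ := h s hs
    exact ⟨U, hU, fun z hz => prism_eq_zero f _ ξ hξ z (fun i => hT (hz i)) fun i => hfT (hz i)⟩

end Prism

/-! ### Tautness of compact sets. -/

section Tautness

variable {R : Type v} [CommRing R] {Z : Type u} [TopologicalSpace Z]

theorem locallyZeroOn_mono {S T : Set Z} (h : S ⊆ T) (q : ℕ) :
    locallyZeroOn R T q ≤ locallyZeroOn R S q := by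
  intro ξ hξ s hs
  obtain ⟨U, hU, h1⟩ := hξ s (h hs)
  exact ⟨U, hU, fun z hz => h1 z fun i => ⟨(hz i).1, h (hz i).2⟩⟩

theorem coboundary_mem_locallyZeroOn {S : Set Z} {q : ℕ} {ξ : Cochain R Z q}
    (h : ξ ∈ locallyZeroOn R S q) : coboundary R q ξ ∈ locallyZeroOn R S (q + 1) := by
  intro s hs
  obtain ⟨U, hU, h1⟩ := h s hs
  exact ⟨U, hU, coboundary_eq_zero h1⟩

theorem coboundary_mem_locallyZero {K : Set Z} {q : ℕ} {ξ : Cochain R Z q}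
    (h : ξ ∈ coboundaries R K q) : coboundary R q ξ ∈ locallyZero R Z (q + 1) := by
  cases q with
  | zero => exact coboundary_mem_locallyZeroOn h
  | succ q =>
    obtain ⟨η, hη, ζ, ⟨φ, hφ, rfl⟩, rfl⟩ := Submodule.mem_sup.1 h
    rw [map_add, coboundary_coboundary, add_zero]
    exact coboundary_mem_locallyZeroOn hη

theorem locallyZero_le_coboundaries (K : Set Z) (q : ℕ) :
    locallyZero R Z q ≤ coboundaries R K q := by
  cases q with
  | zero => exact le_rfl
  | succ q => exact le_sup_left

theorem coboundaries_le_cocycles (K : Set Z) (q : ℕ) :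
    coboundaries R K q ≤ cocycles R K q := by
  intro ξ hξ
  refine ⟨?_, coboundary_mem_locallyZero hξ⟩
  cases q with
  | zero => exact locallyZeroOn_mono (subset_univ K) 0 hξ
  | succ q =>
    obtain ⟨η, hη, ζ, ⟨φ, hφ, rfl⟩, rfl⟩ := Submodule.mem_sup.1 hξ
    exact Submodule.add_mem _ (locallyZeroOn_mono (subset_univ K) _ hη)
      (coboundary_mem_locallyZeroOn hφ)

theorem VanishesNear.coboundary {K : Set Z} {q : ℕ} {ξ : Cochain R Z q} (h : VanishesNear K ξ) :
    VanishesNear K (coboundary R q ξ) := by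
  obtain ⟨P, hP, h1⟩ := h
  exact ⟨P, hP, coboundary_eq_zero h1⟩

/-- The cochains that vanish near `K`. -/
def vanishingNear (R : Type v) [CommRing R] (K : Set Z) (q : ℕ) : Submodule R (Cochain R Z q) where
  carrier := {ξ | VanishesNear K ξ}
  zero_mem' := ⟨univ, Filter.univ_mem, fun _ _ => rfl⟩
  add_mem' := by
    rintro ξ η ⟨P, hP, h1⟩ ⟨Q, hQ, h2⟩
    refine ⟨P ∩ Q, Filter.inter_mem hP hQ, fun z hz => ?_⟩
    simp [h1 z fun i => (hz i).1, h2 z fun i => (hz i).2]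
  smul_mem' := by
    rintro c ξ ⟨P, hP, h1⟩
    exact ⟨P, hP, fun z hz => by simp [h1 z hz]⟩

theorem vanishingNear_le_locallyZeroOn (K : Set Z) (q : ℕ) :
    vanishingNear R K q ≤ locallyZeroOn R K q := by
  rintro ξ ⟨P, hP, h⟩ s hs
  exact ⟨P, mem_nhdsSet_iff_forall.1 hP s hs, fun z hz => h z fun i => (hz i).1⟩

/-- A neighbourhood of a compact set `K` in a regular space admits a (discontinuous) map to `K`
that is the identity on `K` and subordinate to given neighbourhoods of the points of `K`. -/
theorem exists_subordinate_retraction [RegularSpace Z] {K : Set Z} (hK : IsCompact K)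
    (U : Z → Set Z) (hU : ∀ s ∈ K, U s ∈ 𝓝 s) :
    ∃ (N : Set Z) (f : Z → Z), IsOpen N ∧ K ⊆ N ∧ (∀ x ∈ K, f x = x) ∧
      ∀ x ∈ N, ∃ s ∈ K, ∃ W ∈ 𝓝 x, W ⊆ U s ∧ MapsTo f W (U s ∩ K) := by
  classical
  have hC : ∀ s, ∃ C : Set Z, IsClosed C ∧ (s ∈ K → C ∈ 𝓝 s) ∧ (s ∈ K → C ⊆ U s) := by
    intro s
    by_cases hs : s ∈ K
    · obtain ⟨C, h1, h2, h3⟩ := exists_mem_nhds_isClosed_subset (hU s hs)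
      exact ⟨C, h2, fun _ => h1, fun _ => h3⟩
    · exact ⟨∅, isClosed_empty, fun h => absurd h hs, fun h => absurd h hs⟩
  choose C hCc hCn hCU using hC
  obtain ⟨t, htK, ht⟩ := hK.elim_nhds_subcover (fun s => interior (C s))
    fun s hs => interior_mem_nhds.2 (hCn s hs)
  -- `O y` consists of the points that may be sent to `y`: if `x` lies in some `C s`, then `y` must
  -- lie in `U s`. It is open because only finitely many closed sets `C s` are removed.
  let O : Z → Set Z := fun y => ⋂ s ∈ t, {x | x ∈ C s → y ∈ U s}
  have hO : ∀ y, IsOpen (O y) := by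
    intro y
    refine isOpen_biInter_finset fun s _ => ?_
    by_cases hy : y ∈ U s
    · simp [hy]
    · simpa [hy, compl_def] using (hCc s).isOpen_compl
  have hyO : ∀ y, y ∈ O y := fun y => by
    simp only [O, mem_iInter, mem_ofPred_eq]
    exact fun s hs h => hCU s (htK s hs) h
  let M : Set Z := ⋃ y ∈ K, O y
  have hM : ∀ x ∈ M, ∃ y ∈ K, x ∈ O y := fun x hx => by simpa [M] using hx
  choose! f hfK hfO using hM
  have hKM : K ⊆ M := fun y hy => mem_biUnion hy (hyO y)
  refine ⟨M ∩ ⋃ s ∈ t, interior (C s), fun x => if x ∈ K then x else f x,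
    (isOpen_biUnion fun y _ => hO y).inter (isOpen_biUnion fun _ _ => isOpen_interior),
    fun y hy => ⟨hKM hy, ht hy⟩, fun x hx => if_pos hx, ?_⟩
  rintro x ⟨hxM, hx⟩
  obtain ⟨s, hs, hxs⟩ := by simpa only [mem_iUnion, exists_prop] using hx
  refine ⟨s, htK s hs, M ∩ interior (C s),
    ((isOpen_biUnion fun y _ => hO y).inter isOpen_interior).mem_nhds ⟨hxM, hxs⟩,
    fun y hy => hCU s (htK s hs) (interior_subset hy.2), fun y hy => ?_⟩
  have hyC : y ∈ C s := interior_subset hy.2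
  by_cases hyK : y ∈ K
  · simpa [hyK] using hCU s (htK s hs) hyC
  · have h := hfO y hy.1
    simp only [O, mem_iInter, mem_ofPred_eq] at h
    simpa [hyK] using And.intro (h s hs hyC) (hfK y hy.1)

/-- Tautness of compact sets: a cochain that is zero on small tuples in `K`, and whose coboundary
is zero on small tuples near `K`, differs by a relative coboundary from a cochain that vanishes
near `K`. -/
theorem exists_vanishesNear_sub_mem_coboundaries [T2Space Z] [NormalSpace Z] {K : Set Z}
    (hK : IsCompact K) {q : ℕ} {ξ : Cochain R Z q} (hξ : ξ ∈ locallyZeroOn R K q)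
    (hdξ : ∀ s ∈ K, ∃ U ∈ 𝓝 s, ∀ z : Fin (q + 2) → Z, (∀ i, z i ∈ U) → coboundary R q ξ z = 0) :
    ∃ η : Cochain R Z q, VanishesNear K η ∧ η - ξ ∈ coboundaries R K q := by
  classical
  have hU : ∀ s, ∃ U : Set Z, s ∈ K → U ∈ 𝓝 s ∧
      (∀ z : Fin (q + 1) → Z, (∀ i, z i ∈ U ∩ K) → ξ z = 0) ∧
      (∀ z : Fin (q + 2) → Z, (∀ i, z i ∈ U) → coboundary R q ξ z = 0) := by
    intro s
    by_cases hs : s ∈ K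
    · obtain ⟨U, hU, h1⟩ := hξ s hs
      obtain ⟨V, hV, h2⟩ := hdξ s hs
      exact ⟨U ∩ V, fun _ => ⟨Filter.inter_mem hU hV,
        fun z hz => h1 z fun i => ⟨(hz i).1.1, (hz i).2⟩, fun z hz => h2 z fun i => (hz i).2⟩⟩
    · exact ⟨∅, fun h => absurd h hs⟩
  choose U hU using hU
  obtain ⟨N, f, hN, hKN, hfK, hf⟩ := exists_subordinate_retraction hK U fun s hs => (hU s hs).1
  have hmem := pullback_sub_prism_sub_mem_coboundaries (K := K) f q ξ fun s hs =>
    ⟨U s, (hU s hs).1, U s ∩ K, subset_rfl, fun x hx => by rwa [hfK x hx.2], (hU s hs).2.1⟩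
  obtain ⟨P, hP, hKP, hPN⟩ := normal_exists_closure_subset hK.isClosed hN hKN
  -- `ζ` is cohomologous to `ξ` and locally zero on `N`: `f` sends small sets into some `U s ∩ K`,
  -- where `ξ` vanishes, and points and images share `U s`, where `∂ξ` vanishes.
  set ζ : Cochain R Z q := cochainPullback R f q ξ - prism f (q + 1) (coboundary R q ξ) with hζ
  have hζN : ∀ x ∈ N, ∃ W ∈ 𝓝 x, ∀ z : Fin (q + 1) → Z, (∀ i, z i ∈ W) → ζ z = 0 := by
    intro x hx
    obtain ⟨s, hs, W, hW, hWU, hfW⟩ := hf x hx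
    refine ⟨W, hW, fun z hz => ?_⟩
    have h1 : cochainPullback R f q ξ z = 0 := (hU s hs).2.1 _ fun i => hfW (hz i)
    have h2 : prism f (q + 1) (coboundary R q ξ) z = 0 :=
      prism_eq_zero f _ _ (hU s hs).2.2 z (fun i => hWU (hz i)) fun i => (hfW (hz i)).1
    rw [hζ, Pi.sub_apply, h1, h2, sub_zero]
  -- Locally zero need not mean zero on a whole neighbourhood of `K`. Subtracting the part of `ζ`
  -- supported on tuples in `P` achieves this, and that part is locally zero on all of `Z` because
  -- `closure P ⊆ N`.
  let θ : Cochain R Z q := fun z => if ∀ i, z i ∈ P then ζ z else 0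
  have hθ : θ ∈ locallyZero R Z q := by
    intro x _
    by_cases hx : x ∈ closure P
    · obtain ⟨W, hW, h⟩ := hζN x (hPN hx)
      refine ⟨W, hW, fun z hz => ?_⟩
      simp [θ, h z fun i => (hz i).1]
    · refine ⟨(closure P)ᶜ, isClosed_closure.isOpen_compl.mem_nhds hx, fun z hz => if_neg ?_⟩
      exact fun h => (hz 0).1 (subset_closure (h 0))
  refine ⟨ζ - θ, ⟨P, hP.mem_nhdsSet.2 hKP, fun z hz => ?_⟩, ?_⟩
  · simp [θ, hz]
  · rw [sub_right_comm]
    exact Submodule.sub_mem _ hmem (locallyZero_le_coboundaries K q hθ)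

end Tautness

/-! ### Descent of cocycles to the quotient `Z/K`. -/

section CollapseSpace

variable {R : Type v} [CommRing R] {Z : Type u} [TopologicalSpace Z]

theorem collapseMap_eq_iff {K : Set Z} {x y : Z} :
    collapseMap K x = collapseMap K y ↔ x = y ∨ (x ∈ K ∧ y ∈ K) :=
  Quotient.eq (r := collapseSetoid K)

theorem preimage_image_collapseMap {K P : Set Z} (h : K ⊆ P ∨ Disjoint P K) :
    collapseMap K ⁻¹' (collapseMap K '' P) = P := by
  refine Subset.antisymm ?_ (subset_preimage_image _ _)
  rintro x ⟨y, hy, hxy⟩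
  rcases collapseMap_eq_iff.1 hxy with rfl | ⟨hyK, hxK⟩
  · exact hy
  · rcases h with h | h
    · exact h hxK
    · exact absurd hyK (disjoint_left.1 h hy)

theorem isOpen_image_collapseMap {K P : Set Z} (hP : IsOpen P) (h : K ⊆ P ∨ Disjoint P K) :
    IsOpen (collapseMap K '' P) := by
  have hq : IsQuotientMap (collapseMap K) := isQuotientMap_quotient_mk'
  rw [← hq.isOpen_preimage, preimage_image_collapseMap h]
  exact hP

theorem image_collapseMap_mem_nhdsSet {K P : Set Z} (hP : P ∈ 𝓝ˢ K) :
    collapseMap K '' P ∈ 𝓝ˢ (collapsePoint K) := by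
  obtain ⟨V, hV, hKV, hVP⟩ := mem_nhdsSet_iff_exists.1 hP
  exact Filter.mem_of_superset
    ((isOpen_image_collapseMap hV (Or.inl hKV)).mem_nhdsSet.2 (image_mono hKV)) (image_mono hVP)

theorem preimage_collapseMap_mem_nhdsSet {K : Set Z} {Q : Set (Collapse K)}
    (hQ : Q ∈ 𝓝ˢ (collapsePoint K)) : collapseMap K ⁻¹' Q ∈ 𝓝ˢ K :=
  (collapseMap K).continuous.tendsto_nhdsSet (mapsTo_image _ K) hQ

theorem collapseMap_out {K : Set Z} (x : Collapse K) : collapseMap K x.out = x :=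
  Quotient.out_eq x

theorem out_collapseMap_mem {K P : Set Z} (h : K ⊆ P ∨ Disjoint P K) {x : Z} (hx : x ∈ P) :
    (collapseMap K x).out ∈ P := by
  rw [← preimage_image_collapseMap h, mem_preimage, collapseMap_out]
  exact mem_image_of_mem _ hx

/-- A relative cocycle of `(Z, K)` that vanishes near `K` comes, up to a relative coboundary, from
a relative cocycle of the quotient `Z/K` that vanishes near the base point. -/
theorem exists_collapse_cocycle {K : Set Z} (hK : IsClosed K) {q : ℕ} {ξ : Cochain R Z q}
    (hξ : ξ ∈ cocycles R K q) (hv : VanishesNear K ξ) :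
    ∃ η ∈ cocycles R (collapsePoint K) q, VanishesNear (collapsePoint K) η ∧
      cochainPullback R (collapseMap K) q η - ξ ∈ coboundaries R K q := by
  obtain ⟨P, hP, hPξ⟩ := hv
  have hKP : K ⊆ P := subset_of_mem_nhdsSet hP
  have hPdξ : ∀ z : Fin (q + 2) → Z, (∀ i, z i ∈ P) → coboundary R q ξ z = 0 :=
    coboundary_eq_zero hPξ
  have hout : ∀ {V : Set Z}, K ⊆ V ∨ Disjoint V K →
      ∀ {x : Collapse K}, x ∈ collapseMap K '' V → x.out ∈ V := by
    rintro V h x ⟨y, hy, rfl⟩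
    exact out_collapseMap_mem h hy
  -- every point has a saturated open neighbourhood on which the coboundary vanishes
  have hloc : ∀ x : Z, ∃ V, IsOpen V ∧ x ∈ V ∧ (K ⊆ V ∨ Disjoint V K) ∧
      ∀ z : Fin (q + 2) → Z, (∀ i, z i ∈ V) → coboundary R q ξ z = 0 := by
    intro x
    by_cases hx : x ∈ K
    · obtain ⟨V, hV, hKV, hVP⟩ := mem_nhdsSet_iff_exists.1 hP
      exact ⟨V, hV, hKV hx, Or.inl hKV, fun z hz => hPdξ z fun i => hVP (hz i)⟩
    · obtain ⟨U, hU, h⟩ := hξ.2 x (mem_univ x)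
      obtain ⟨V, hVU, hV, hxV⟩ := mem_nhds_iff.1 hU
      exact ⟨V ∩ Kᶜ, hV.inter hK.isOpen_compl, ⟨hxV, hx⟩,
        Or.inr (disjoint_left.2 fun y hy => hy.2),
        fun z hz => h z fun i => ⟨hVU (hz i).1, mem_univ _⟩⟩
  -- The descended cocycle is the pullback along the discontinuous section `Quotient.out`, which
  -- stays inside saturated sets.
  have hvan : VanishesNear (collapsePoint K) (cochainPullback R Quotient.out q ξ) :=
    ⟨_, image_collapseMap_mem_nhdsSet hP, fun z hz => hPξ _ fun i => hout (Or.inl hKP) (hz i)⟩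
  refine ⟨cochainPullback R Quotient.out q ξ,
    ⟨vanishingNear_le_locallyZeroOn _ _ hvan, ?_⟩, hvan, ?_⟩
  · intro y _
    obtain ⟨x, rfl⟩ : ∃ x, collapseMap K x = y := ⟨y.out, collapseMap_out y⟩
    obtain ⟨V, hV, hxV, hs, h⟩ := hloc x
    exact ⟨_, (isOpen_image_collapseMap hV hs).mem_nhds (mem_image_of_mem _ hxV),
      fun z hz => h _ fun i => hout hs (hz i).1⟩
  -- The section after the projection maps every saturated set into itself, so the prism correction
  -- is locally zero.
  · have hmem := pullback_sub_prism_sub_mem_coboundaries (K := K)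
      (fun x => (collapseMap K x).out) q ξ fun s hs =>
        ⟨P, mem_nhdsSet_iff_forall.1 hP s hs, P, inter_subset_left,
          fun x hx => out_collapseMap_mem (Or.inl hKP) hx.1, hPξ⟩
    have hz : prism (fun x => (collapseMap K x).out) (q + 1) (coboundary R q ξ) ∈
        locallyZero R Z q := by
      intro x _
      obtain ⟨V, hV, hxV, hs, h⟩ := hloc x
      exact ⟨V, hV.mem_nhds hxV, fun z hz => prism_eq_zero _ _ _ h z (fun i => (hz i).1)
        fun i => out_collapseMap_mem hs (hz i).1⟩
    have := Submodule.add_mem _ hmem (locallyZero_le_coboundaries K q hz)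
    rwa [sub_right_comm, sub_add_cancel] at this

end CollapseSpace

/-! ### Evaluation of power series on cochains. -/

section SeriesCochain

variable {R : Type v} [CommRing R] {Z : Type u}

theorem seriesCochain_eq_sum {q : ℕ} {g : Z → Z} (A : PowerSeries R) {ξ : Cochain R Z q}
    {z : Fin (q + 1) → Z} {n : ℕ} (h : ∀ j ≥ n, ξ (fun i => g^[j] (z i)) = 0) :
    seriesCochain g A ξ z =
      ∑ j ∈ Finset.range n, PowerSeries.coeff j A * ξ (fun i => g^[j] (z i)) := by
  refine finsum_eq_finsetSum_of_support_subset _ fun j hj => ?_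
  rw [Finset.mem_coe, Finset.mem_range]
  by_contra hn
  exact hj (by simp [h j (not_lt.1 hn)])

theorem seriesCochain_C {q : ℕ} (g : Z → Z) (c : R) (ξ : Cochain R Z q) :
    seriesCochain g (PowerSeries.C c) ξ = c • ξ := by
  funext z
  rw [seriesCochain, finsum_eq_single _ 0 fun j hj => by simp [PowerSeries.coeff_C, hj]]
  simp

theorem seriesCochain_X {q : ℕ} (g : Z → Z) (ξ : Cochain R Z q) :
    seriesCochain g PowerSeries.X ξ = cochainPullback R g q ξ := by
  funext z
  rw [seriesCochain, finsum_eq_single _ 1 fun j hj => by simp [PowerSeries.coeff_X, hj]]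
  simp [cochainPullback]

end SeriesCochain

/-! ### The action of power series over a global attractor. -/

section Attractor

variable {R : Type v} [CommRing R] {Z : Type u} [TopologicalSpace Z] {g : C(Z, Z)} {K : Set Z}

/-- Every point has a neighbourhood whose iterates eventually stay in a given neighbourhood of the
attractor. -/
theorem IsGlobalAttractor.exists_nhds_iterate_mem (hK : IsGlobalAttractor g K) {P : Set Z}
    (hP : P ∈ 𝓝ˢ K) (x : Z) : ∃ U ∈ 𝓝 x, ∃ n : ℕ, ∀ y ∈ U, ∀ j ≥ n, g^[j] y ∈ P := by
  obtain ⟨Q, hQ, hQP, hgQ⟩ := hK.stable P hP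
  obtain ⟨n, hn⟩ := hK.attracts x (interior Q)
    (isOpen_interior.mem_nhdsSet.2 (subset_interior_iff_mem_nhdsSet.2 hQ))
  -- Entering the positively invariant `Q` once is enough to stay in `P` at all later times.
  refine ⟨g^[n] ⁻¹' interior Q,
    (isOpen_interior.preimage (g.continuous.iterate n)).mem_nhds hn, n, fun y hy j hj => hQP ?_⟩
  obtain ⟨k, rfl⟩ := Nat.exists_eq_add_of_le' hj
  rw [Function.iterate_add_apply]
  exact hgQ.iterate k (interior_subset hy)

theorem IsGlobalAttractor.exists_iterate_mem (hK : IsGlobalAttractor g K) {P : Set Z}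
    (hP : P ∈ 𝓝ˢ K) {m : ℕ} (z : Fin m → Z) : ∃ n : ℕ, ∀ j ≥ n, ∀ i, g^[j] (z i) ∈ P := by
  choose U hU n hn using fun i => hK.exists_nhds_iterate_mem hP (z i)
  exact ⟨Finset.univ.sup n, fun j hj i => hn i _ (mem_of_mem_nhds (hU i)) j
    ((Finset.le_sup (Finset.mem_univ i)).trans hj)⟩

theorem IsGlobalAttractor.exists_eventually_zero (hK : IsGlobalAttractor g K) {q : ℕ}
    {ξ : Cochain R Z q} (hξ : VanishesNear K ξ) (z : Fin (q + 1) → Z) :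
    ∃ n : ℕ, ∀ j ≥ n, ξ (fun i => g^[j] (z i)) = 0 := by
  obtain ⟨P, hP, h⟩ := hξ
  obtain ⟨n, hn⟩ := hK.exists_iterate_mem hP z
  exact ⟨n, fun j hj => h _ (hn j hj)⟩

theorem IsGlobalAttractor.seriesCochain_vanishesNear (hK : IsGlobalAttractor g K) {q : ℕ}
    (A : PowerSeries R) {ξ : Cochain R Z q} (hξ : VanishesNear K ξ) :
    VanishesNear K (seriesCochain g A ξ) := by
  obtain ⟨P, hP, h⟩ := hξ
  obtain ⟨Q, hQ, hQP, hgQ⟩ := hK.stable P hP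
  refine ⟨Q, hQ, fun z hz => ?_⟩
  rw [seriesCochain_eq_sum A (n := 0) fun j _ => h _ fun i => hQP (hgQ.iterate j (hz i))]
  simp

/-- Near `x` only the terms with `j < n` survive, so finitely many neighbourhoods of the points
`g^[j] x` need to be pulled back and intersected. -/
theorem IsGlobalAttractor.seriesCochain_mem_locallyZero (hK : IsGlobalAttractor g K) {q : ℕ}
    (A : PowerSeries R) {ξ : Cochain R Z q} (hξ : VanishesNear K ξ) (h0 : ξ ∈ locallyZero R Z q) :
    seriesCochain g A ξ ∈ locallyZero R Z q := by
  intro x _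
  obtain ⟨P, hP, h⟩ := hξ
  obtain ⟨U, hU, n, hn⟩ := hK.exists_nhds_iterate_mem hP x
  choose V hV hVξ using fun j => h0 (g^[j] x) (mem_univ _)
  refine ⟨U ∩ ⋂ j ∈ Finset.range n, g^[j] ⁻¹' V j, Filter.inter_mem hU
    ((Filter.biInter_finset_mem _).2 fun j _ =>
      (g.continuous.iterate j).continuousAt (hV j)), fun z hz => ?_⟩
  rw [seriesCochain_eq_sum A fun j hj => h _ fun i => hn _ (hz i).1.1 j hj]
  refine Finset.sum_eq_zero fun j hj => ?_
  rw [hVξ j _ fun i => ⟨mem_iInter₂.1 (hz i).1.2 j hj, mem_univ _⟩, mul_zero]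

theorem IsGlobalAttractor.coboundary_seriesCochain (hK : IsGlobalAttractor g K) {q : ℕ}
    (A : PowerSeries R) {ξ : Cochain R Z q} (hξ : VanishesNear K ξ) :
    coboundary R q (seriesCochain g A ξ) = seriesCochain g A (coboundary R q ξ) := by
  funext z
  obtain ⟨P, hP, h⟩ := hξ
  obtain ⟨n, hn⟩ := hK.exists_iterate_mem hP z
  rw [seriesCochain_eq_sum A fun j hj => coboundary_eq_zero h _ (hn j hj)]
  simp only [coboundary, LinearMap.coe_mk, AddHom.coe_mk, Finset.mul_sum]
  rw [Finset.sum_comm]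
  refine Finset.sum_congr rfl fun k _ => ?_
  rw [seriesCochain_eq_sum A fun j hj => h _ fun i => hn j hj _, Finset.mul_sum]
  exact Finset.sum_congr rfl fun j _ => by ring

variable (R K) in
/-- The relative cocycles that vanish near `K`. -/
def nearCocycles (q : ℕ) : Submodule R (Cochain R Z q) :=
  cocycles R K q ⊓ vanishingNear R K q

theorem IsGlobalAttractor.seriesCochain_mem_nearCocycles (hK : IsGlobalAttractor g K) {q : ℕ}
    (A : PowerSeries R) {ξ : Cochain R Z q} (hξ : ξ ∈ nearCocycles R K q) :
    seriesCochain g A ξ ∈ nearCocycles R K q := by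
  have hv := hK.seriesCochain_vanishesNear A hξ.2
  refine ⟨⟨vanishingNear_le_locallyZeroOn K q hv, ?_⟩, hv⟩
  change coboundary R q (seriesCochain g A ξ) ∈ locallyZero R Z (q + 1)
  rw [hK.coboundary_seriesCochain A hξ.2]
  exact hK.seriesCochain_mem_locallyZero A (VanishesNear.coboundary hξ.2) hξ.1.2

theorem IsGlobalAttractor.seriesCochain_add (hK : IsGlobalAttractor g K) {q : ℕ}
    (A : PowerSeries R) {ξ η : Cochain R Z q} (hξ : VanishesNear K ξ) (hη : VanishesNear K η) :
    seriesCochain g A (ξ + η) = seriesCochain g A ξ + seriesCochain g A η := by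
  funext z
  obtain ⟨n, hn⟩ := hK.exists_eventually_zero hξ z
  obtain ⟨m, hm⟩ := hK.exists_eventually_zero hη z
  have h1 : ∀ j ≥ max n m, ξ (fun i => g^[j] (z i)) = 0 := fun j hj => hn j (le_of_max_le_left hj)
  have h2 : ∀ j ≥ max n m, η (fun i => g^[j] (z i)) = 0 := fun j hj => hm j (le_of_max_le_right hj)
  rw [Pi.add_apply, seriesCochain_eq_sum A h1, seriesCochain_eq_sum A h2,
    seriesCochain_eq_sum A (n := max n m) fun j hj => by rw [Pi.add_apply, h1 j hj, h2 j hj,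
      add_zero], ← Finset.sum_add_distrib]
  exact Finset.sum_congr rfl fun j _ => by rw [Pi.add_apply, mul_add]

theorem IsGlobalAttractor.seriesCochain_smul (hK : IsGlobalAttractor g K) {q : ℕ}
    (A : PowerSeries R) (c : R) {ξ : Cochain R Z q} (hξ : VanishesNear K ξ) :
    seriesCochain g A (c • ξ) = c • seriesCochain g A ξ := by
  funext z
  obtain ⟨n, hn⟩ := hK.exists_eventually_zero hξ z
  rw [Pi.smul_apply, seriesCochain_eq_sum A hn, seriesCochain_eq_sum A (n := n) fun j hj => by
    rw [Pi.smul_apply, hn j hj, smul_zero], Finset.smul_sum]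
  exact Finset.sum_congr rfl fun j _ => by rw [Pi.smul_apply, mul_smul_comm]

theorem IsGlobalAttractor.add_seriesCochain (hK : IsGlobalAttractor g K) {q : ℕ}
    (A B : PowerSeries R) {ξ : Cochain R Z q} (hξ : VanishesNear K ξ) :
    seriesCochain g (A + B) ξ = seriesCochain g A ξ + seriesCochain g B ξ := by
  funext z
  obtain ⟨n, hn⟩ := hK.exists_eventually_zero hξ z
  rw [Pi.add_apply, seriesCochain_eq_sum _ hn, seriesCochain_eq_sum _ hn,
    seriesCochain_eq_sum _ hn, ← Finset.sum_add_distrib]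
  exact Finset.sum_congr rfl fun j _ => by rw [map_add, add_mul]

theorem IsGlobalAttractor.mul_seriesCochain (hK : IsGlobalAttractor g K) {q : ℕ}
    (A B : PowerSeries R) {ξ : Cochain R Z q} (hξ : VanishesNear K ξ) :
    seriesCochain g (A * B) ξ = seriesCochain g A (seriesCochain g B ξ) := by
  funext z
  obtain ⟨n, hn⟩ := hK.exists_eventually_zero hξ z
  have hshift : ∀ m j : ℕ, (fun i => g^[j] (g^[m] (z i))) = fun i => g^[m + j] (z i) := fun m j =>
    funext fun i => by rw [add_comm m j, Function.iterate_add_apply]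
  have hB : ∀ m, seriesCochain g B ξ (fun i => g^[m] (z i)) =
      ∑ j ∈ Finset.range (n - m), PowerSeries.coeff j B * ξ (fun i => g^[m + j] (z i)) := by
    intro m
    rw [seriesCochain_eq_sum B (n := n - m) fun j hj => by
      rw [hshift]; exact hn _ (by omega)]
    simp only [hshift]
  rw [seriesCochain_eq_sum _ hn, seriesCochain_eq_sum A (n := n) fun m hm => by
    rw [hB, Nat.sub_eq_zero_of_le hm, Finset.sum_range_zero]]
  simp only [hB, Finset.mul_sum]
  -- The surviving pairs fill the triangle `a + b < n`; summing it along diagonals produces the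
  -- Cauchy product coefficients.
  rw [← Finset.sum_range_diag_flip n fun a b => PowerSeries.coeff a A *
    (PowerSeries.coeff b B * ξ (fun i => g^[a + b] (z i)))]
  refine Finset.sum_congr rfl fun k _ => ?_
  rw [PowerSeries.coeff_mul, Finset.Nat.sum_antidiagonal_eq_sum_range_succ_mk, Finset.sum_mul]
  refine Finset.sum_congr rfl fun a ha => ?_
  rw [Nat.add_sub_cancel' (Nat.lt_succ_iff.1 (Finset.mem_range.1 ha)), mul_assoc]

/-- The action of formal power series on the cocycles that vanish near the attractor. -/
noncomputable def IsGlobalAttractor.seriesHom (hK : IsGlobalAttractor g K) (q : ℕ) :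
    PowerSeries R →+* Module.End R (nearCocycles R K q) where
  toFun A :=
    { toFun := fun ξ => ⟨seriesCochain g A ξ, hK.seriesCochain_mem_nearCocycles A ξ.2⟩
      map_add' := fun ξ η => Subtype.ext (hK.seriesCochain_add A ξ.2.2 η.2.2)
      map_smul' := fun c ξ => Subtype.ext (hK.seriesCochain_smul A c ξ.2.2) }
  map_one' := LinearMap.ext fun ξ => Subtype.ext <| by
    have := seriesCochain_C (g := g) (1 : R) (ξ : Cochain R Z q)
    rwa [map_one, one_smul] at this
  map_zero' := LinearMap.ext fun ξ => Subtype.ext <| by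
    have := seriesCochain_C (g := g) (0 : R) (ξ : Cochain R Z q)
    rwa [map_zero, zero_smul] at this
  map_add' A B := LinearMap.ext fun ξ => Subtype.ext (hK.add_seriesCochain A B ξ.2.2)
  map_mul' A B := LinearMap.ext fun ξ => Subtype.ext (hK.mul_seriesCochain A B ξ.2.2)

/-- A primitive `φ` of `ξ`, up to a locally zero `ζ`, is only locally zero on `K`, so the series
need not be finite on it. Since `∂φ` vanishes on small tuples near `K`, tautness replaces `φ` by a
`ψ` vanishing near `K`, on which the series commutes with `∂`. -/
theorem IsGlobalAttractor.seriesCochain_mem_coboundaries [T2Space Z] [NormalSpace Z]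
    (hK : IsGlobalAttractor g K) {q : ℕ} (A : PowerSeries R) {ξ : Cochain R Z q}
    (hξ : VanishesNear K ξ) (hb : ξ ∈ coboundaries R K q) :
    seriesCochain g A ξ ∈ coboundaries R K q := by
  cases q with
  | zero => exact hK.seriesCochain_mem_locallyZero A hξ hb
  | succ q =>
    obtain ⟨ζ, hζ, -, ⟨φ, hφ, rfl⟩, rfl⟩ := Submodule.mem_sup.1 hb
    obtain ⟨ψ, hψ, hφψ⟩ := exists_vanishesNear_sub_mem_coboundaries hK.isCompact hφ fun s hs => by
      obtain ⟨P, hP, h1⟩ := hξ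
      obtain ⟨U, hU, h2⟩ := hζ s (mem_univ s)
      refine ⟨P ∩ U, Filter.inter_mem (mem_nhdsSet_iff_forall.1 hP s hs) hU, fun z hz => ?_⟩
      have h3 := h1 z fun i => (hz i).1
      rwa [Pi.add_apply, h2 z fun i => ⟨(hz i).2, mem_univ _⟩, zero_add] at h3
    have hd := coboundary_mem_locallyZero hφψ
    rw [map_sub] at hd
    -- The error `ξ - ∂ψ` is both locally zero and zero near `K`, as preservation of local vanishing
    -- requires.
    set ω := ζ + coboundary R q φ - coboundary R q ψ with hω
    have hω0 : ω ∈ locallyZero R Z (q + 1) := by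
      have := Submodule.sub_mem _ hζ hd
      rwa [sub_sub_eq_add_sub, ← hω] at this
    have hωv : VanishesNear K ω :=
      (vanishingNear R K (q + 1)).sub_mem hξ (VanishesNear.coboundary hψ)
    rw [show ζ + coboundary R q φ = ω + coboundary R q ψ by rw [hω, sub_add_cancel],
      hK.seriesCochain_add A hωv (VanishesNear.coboundary hψ), ← hK.coboundary_seriesCochain A hψ]
    exact Submodule.add_mem_sup (hK.seriesCochain_mem_locallyZero A hωv hω0)
      ⟨_, vanishingNear_le_locallyZeroOn K q (hK.seriesCochain_vanishesNear A hψ), rfl⟩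

variable (R K) in
/-- The class of a cocycle that vanishes near `K`. -/
def nearClass (q : ℕ) : nearCocycles R K q →ₗ[R] Cohomology R K q :=
  Submodule.mkQ _ ∘ₗ Submodule.inclusion inf_le_left

theorem classOf_eq_classOf {q : ℕ} {ξ η : Cochain R Z q} {hξ : ξ ∈ cocycles R K q}
    {hη : η ∈ cocycles R K q} : classOf ξ hξ = classOf η hη ↔ ξ - η ∈ coboundaries R K q :=
  Submodule.Quotient.eq _

theorem classOf_congr {q : ℕ} {ξ η : Cochain R Z q} {hξ : ξ ∈ cocycles R K q}
    {hη : η ∈ cocycles R K q} (h : ξ = η) : classOf ξ hξ = classOf η hη := by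
  subst h
  rfl

theorem nearClass_eq_zero {q : ℕ} {ξ : nearCocycles R K q} :
    nearClass R K q ξ = 0 ↔ (ξ : Cochain R Z q) ∈ coboundaries R K q :=
  Submodule.Quotient.mk_eq_zero _

theorem nearClass_surjective [T2Space Z] [NormalSpace Z] (hK : IsCompact K) (q : ℕ) :
    Function.Surjective (nearClass R K q) := by
  intro u
  obtain ⟨⟨ξ, hξ⟩, rfl⟩ := Submodule.Quotient.mk_surjective _ u
  obtain ⟨η, hη, h⟩ := exists_vanishesNear_sub_mem_coboundaries hK hξ.1 fun s _ => by
    obtain ⟨U, hU, h⟩ := hξ.2 s (mem_univ s)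
    exact ⟨U, hU, fun z hz => h z fun i => ⟨hz i, mem_univ _⟩⟩
  have hc : η ∈ cocycles R K q := by
    simpa using Submodule.add_mem _ (coboundaries_le_cocycles K q h) hξ
  exact ⟨⟨η, hc, hη⟩, classOf_eq_classOf.2 h⟩

/-- The action of formal power series on the cohomology of `(Z, K)`. -/
noncomputable def IsGlobalAttractor.cohomologySeriesHom [T2Space Z] [NormalSpace Z]
    (hK : IsGlobalAttractor g K) (q : ℕ) :
    PowerSeries R →+* Module.End R (Cohomology R K q) :=
  -- Cohomology is the quotient of the cocycles vanishing near `K` by those that are coboundaries;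
  -- the action descends because it preserves this kernel.
  let e := (nearClass R K q).quotKerEquivOfSurjective (nearClass_surjective hK.isCompact q)
  have h (A : PowerSeries R) : LinearMap.ker (nearClass R K q) ≤
      (LinearMap.ker (nearClass R K q)).comap (hK.seriesHom q A) := fun ξ hξ =>
    nearClass_eq_zero.2 (hK.seriesCochain_mem_coboundaries A ξ.2.2 (nearClass_eq_zero.1 hξ))
  have hΦ (A : PowerSeries R) (ξ : nearCocycles R K q) :
      e.conj (Submodule.mapQ _ _ (hK.seriesHom q A) (h A)) (nearClass R K q ξ) =
        nearClass R K q (hK.seriesHom q A ξ) := by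
    have : e.symm (nearClass R K q ξ) = Submodule.Quotient.mk ξ := e.symm_apply_eq.2 rfl
    rw [LinearEquiv.conj_apply_apply, this]
    rfl
  have hs := nearClass_surjective (R := R) hK.isCompact q
  { toFun A := e.conj (Submodule.mapQ _ _ (hK.seriesHom q A) (h A))
    map_one' := LinearMap.ext fun u => by
      obtain ⟨ξ, rfl⟩ := hs u
      rw [hΦ, map_one]; rfl
    map_zero' := LinearMap.ext fun u => by
      obtain ⟨ξ, rfl⟩ := hs u
      rw [hΦ, map_zero]; exact map_zero _
    map_add' A B := LinearMap.ext fun u => by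
      obtain ⟨ξ, rfl⟩ := hs u
      rw [LinearMap.add_apply, hΦ, hΦ, hΦ, map_add, LinearMap.add_apply, map_add]
    map_mul' A B := LinearMap.ext fun u => by
      obtain ⟨ξ, rfl⟩ := hs u
      rw [Module.End.mul_apply, hΦ, hΦ, hΦ, map_mul, Module.End.mul_apply] }

theorem IsGlobalAttractor.cohomologySeriesHom_nearClass [T2Space Z] [NormalSpace Z]
    (hK : IsGlobalAttractor g K) {q : ℕ} (A : PowerSeries R) (ξ : nearCocycles R K q) :
    hK.cohomologySeriesHom q A (nearClass R K q ξ) = nearClass R K q (hK.seriesHom q A ξ) := by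
  let e := (nearClass R K q).quotKerEquivOfSurjective (nearClass_surjective hK.isCompact q)
  have : e.symm (nearClass R K q ξ) = Submodule.Quotient.mk ξ := e.symm_apply_eq.2 rfl
  change e (Submodule.mapQ _ _ (hK.seriesHom q A) _ (e.symm _)) = _
  rw [this]
  rfl

theorem IsGlobalAttractor.cohomologySeriesHom_C [T2Space Z] [NormalSpace Z]
    (hK : IsGlobalAttractor g K) (q : ℕ) (c : R) :
    hK.cohomologySeriesHom q (PowerSeries.C c) =
      algebraMap R (Module.End R (Cohomology R K q)) c := by
  refine LinearMap.ext fun u => ?_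
  obtain ⟨ξ, rfl⟩ := nearClass_surjective hK.isCompact q u
  rw [hK.cohomologySeriesHom_nearClass, Module.algebraMap_end_apply, ← map_smul]
  exact congrArg _ (Subtype.ext (seriesCochain_C g c ξ.1))

theorem IsGlobalAttractor.cohomologySeriesHom_X [T2Space Z] [NormalSpace Z]
    (hK : IsGlobalAttractor g K) (q : ℕ) :
    hK.cohomologySeriesHom q PowerSeries.X = pullback R g hK.mapsTo q := by
  refine LinearMap.ext fun u => ?_
  obtain ⟨ξ, rfl⟩ := nearClass_surjective hK.isCompact q u
  rw [hK.cohomologySeriesHom_nearClass]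
  exact classOf_congr (seriesCochain_X g ξ.1)

theorem IsGlobalAttractor.cohomologySeriesHom_polynomial [T2Space Z] [NormalSpace Z]
    (hK : IsGlobalAttractor g K) (q : ℕ) (p : Polynomial R) :
    hK.cohomologySeriesHom q (p : PowerSeries R) =
      Polynomial.aeval (pullback R g hK.mapsTo q) p := by
  have : (hK.cohomologySeriesHom q).comp Polynomial.coeToPowerSeries.ringHom =
      (Polynomial.aeval (pullback R g hK.mapsTo q) : _ →ₐ[R] _).toRingHom := by
    refine Polynomial.ringHom_ext (fun c => ?_) ?_
    · simpa using hK.cohomologySeriesHom_C q c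
    · simpa using hK.cohomologySeriesHom_X q
  exact congrArg (fun f => f p) this

theorem IsGlobalAttractor.not_hasEigenvalue [T2Space Z] [NormalSpace Z]
    (hK : IsGlobalAttractor g K) (q : ℕ) {c : R} (hc : IsUnit c) :
    ¬ Module.End.HasEigenvalue (pullback R g hK.mapsTo q) c := by
  intro h
  obtain ⟨u, hu⟩ := h.exists_hasEigenvector
  have hunit : IsUnit (PowerSeries.X - PowerSeries.C c : PowerSeries R) := by
    rw [PowerSeries.isUnit_iff_constantCoeff]
    simpa using hc
  have h2 := hunit.map (hK.cohomologySeriesHom q)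
  rw [map_sub, hK.cohomologySeriesHom_X, hK.cohomologySeriesHom_C] at h2
  refine hu.2 (((Module.End.isUnit_iff _).1 h2).1 ?_)
  rw [map_zero, LinearMap.sub_apply, hu.apply_eq_smul, Module.algebraMap_end_apply, sub_self]

end Attractor

/-! ### The induced dynamics on `Z/K`. -/

section CollapseDynamics

variable {R : Type v} [CommRing R] {Z : Type u} [TopologicalSpace Z] {g : C(Z, Z)} {K : Set Z}

theorem collapseInduced_iterate (h : MapsTo g K K) (j : ℕ) (x : Z) :
    (collapseInduced g h)^[j] (collapseMap K x) = collapseMap K (g^[j] x) := by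
  induction j generalizing x with
  | zero => rfl
  | succ j ih => exact ih (g x)

/-- This transfers finiteness of the sums and the cocycle property to `Z/K`; those lemmas need no
separation axiom there. -/
theorem IsGlobalAttractor.collapse (hK : IsGlobalAttractor g K) (h : MapsTo g K K) :
    IsGlobalAttractor (collapseInduced g h) (collapsePoint K) where
  isCompact := hK.isCompact.image (collapseMap K).continuous
  stable U hU := by
    obtain ⟨P, hP, hPU, hgP⟩ := hK.stable _ (preimage_collapseMap_mem_nhdsSet hU)
    refine ⟨_, image_collapseMap_mem_nhdsSet hP, image_subset_iff.2 hPU, ?_⟩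
    rintro _ ⟨x, hx, rfl⟩
    exact ⟨g x, hgP hx, rfl⟩
  attracts p P hP := by
    obtain ⟨n, hn⟩ := hK.attracts p.out _ (preimage_collapseMap_mem_nhdsSet hP)
    refine ⟨n, ?_⟩
    rw [← collapseMap_out p, collapseInduced_iterate]
    exact hn

theorem cochainPullback_seriesCochain (h : MapsTo g K K) {q : ℕ} (A : PowerSeries R)
    (ξ : Cochain R (Collapse K) q) :
    cochainPullback R (collapseMap K) q (seriesCochain (collapseInduced g h) A ξ) =
      seriesCochain g A (cochainPullback R (collapseMap K) q ξ) := by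
  funext z
  change seriesCochain _ A ξ (fun i => collapseMap K (z i)) = _
  simp only [seriesCochain, collapseInduced_iterate]
  rfl

theorem cochainPullback_mem_nearCocycles {q : ℕ} {ξ : Cochain R (Collapse K) q}
    (hξ : ξ ∈ cocycles R (collapsePoint K) q) (hv : VanishesNear (collapsePoint K) ξ) :
    cochainPullback R (collapseMap K) q ξ ∈ nearCocycles R K q := by
  obtain ⟨P, hP, h⟩ := hv
  exact ⟨cochainPullback_mem_cocycles R _ (mapsTo_image _ K) q hξ,
    _, preimage_collapseMap_mem_nhdsSet hP, fun z hz => h _ hz⟩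

end CollapseDynamics

end AlexanderSpanier

theorem mainTheorem8 {Z : Type*} [TopologicalSpace Z] [T2Space Z] [ParacompactSpace Z]
    {R : Type*} [CommRing R] (g : C(Z, Z)) (K : Set Z)
    (hK : AlexanderSpanier.IsGlobalAttractor g K) (q : ℕ) :
    -- every class of `(Z, K)` comes from a cocycle on `(Z/K, a)` that vanishes near `a`
    (∀ u : AlexanderSpanier.Cohomology R K q,
      ∃ (ξ : AlexanderSpanier.Cochain R (AlexanderSpanier.Collapse K) q)
        (hξ : ξ ∈ AlexanderSpanier.cocycles R (AlexanderSpanier.collapsePoint K) q),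
        AlexanderSpanier.VanishesNear (AlexanderSpanier.collapsePoint K) ξ ∧
        u = AlexanderSpanier.pullback R (AlexanderSpanier.collapseMap K)
          (Set.mapsTo_image _ K) q (AlexanderSpanier.classOf ξ hξ)) ∧
    -- the assignment `A ↦ A(g^*)` is a well defined ring homomorphism
    (∃ Φ : PowerSeries R →+* Module.End R (AlexanderSpanier.Cohomology R K q),
      (∀ (A : PowerSeries R)
        (ξ : AlexanderSpanier.Cochain R (AlexanderSpanier.Collapse K) q)
        (hξ : ξ ∈ AlexanderSpanier.cocycles R (AlexanderSpanier.collapsePoint K) q),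
        AlexanderSpanier.VanishesNear (AlexanderSpanier.collapsePoint K) ξ →
        ((∀ z : Fin (q + 1) → AlexanderSpanier.Collapse K,
          {j : ℕ | ξ (fun i =>
            (AlexanderSpanier.collapseInduced g hK.mapsTo)^[j] (z i)) ≠ 0}.Finite) ∧
        ∃ hS : AlexanderSpanier.seriesCochain
            (AlexanderSpanier.collapseInduced g hK.mapsTo) A ξ ∈
              AlexanderSpanier.cocycles R (AlexanderSpanier.collapsePoint K) q,
          Φ A (AlexanderSpanier.pullback R (AlexanderSpanier.collapseMap K)
              (Set.mapsTo_image _ K) q (AlexanderSpanier.classOf ξ hξ)) =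
            AlexanderSpanier.pullback R (AlexanderSpanier.collapseMap K)
              (Set.mapsTo_image _ K) q (AlexanderSpanier.classOf _ hS))) ∧
      (∀ p : Polynomial R, Φ (p : PowerSeries R) =
        Polynomial.aeval (AlexanderSpanier.pullback R g hK.mapsTo q) p)) ∧
    -- `g^*` has no nonzero eigenvalues
    (∀ c : R, IsUnit c →
      ¬ Module.End.HasEigenvalue (AlexanderSpanier.pullback R g hK.mapsTo q) c) ∧
    (IsField R → ∀ c : R, c ≠ 0 →
      ¬ Module.End.HasEigenvalue (AlexanderSpanier.pullback R g hK.mapsTo q) c) := by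
  -- Paracompactness enters only here, through normality.
  have hnormal : NormalSpace Z := inferInstance
  refine ⟨fun u => ?_, ⟨hK.cohomologySeriesHom q, fun A ξ hξ hv => ⟨fun z => ?_, ?_⟩,
    hK.cohomologySeriesHom_polynomial q⟩, fun c => hK.not_hasEigenvalue q,
    fun hR c hc => hK.not_hasEigenvalue q ?_⟩
  · obtain ⟨ξ, rfl⟩ := AlexanderSpanier.nearClass_surjective hK.isCompact q u
    obtain ⟨η, hη, hv, h⟩ :=
      AlexanderSpanier.exists_collapse_cocycle hK.isCompact.isClosed ξ.2.1 ξ.2.2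
    refine ⟨η, hη, hv, Eq.symm ?_⟩
    exact AlexanderSpanier.classOf_eq_classOf.2 h
  · obtain ⟨n, hn⟩ := (hK.collapse hK.mapsTo).exists_eventually_zero hv z
    refine (Set.finite_lt_nat n).subset fun j hj => ?_
    by_contra hjn
    exact hj (hn j (not_lt.1 hjn))
  · refine ⟨((hK.collapse hK.mapsTo).seriesCochain_mem_nearCocycles A ⟨hξ, hv⟩).1, ?_⟩
    refine (hK.cohomologySeriesHom_nearClass A
      ⟨_, AlexanderSpanier.cochainPullback_mem_nearCocycles hξ hv⟩).trans ?_
    exact AlexanderSpanier.classOf_congr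
      (AlexanderSpanier.cochainPullback_seriesCochain hK.mapsTo A ξ).symm
  · obtain ⟨d, hd⟩ := hR.mul_inv_cancel hc
    exact IsUnit.of_mul_eq_one d hd
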